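/- Let $\phi$ be a Bernstein function with Lévy triplet $(0,0,\nu)$, $\nu(0,\infty)=\infty$, i.e. $\phi(\lambda)=\int_{(0,\infty)}(1-e^{-\lambda t})\,\nu(dt)$ with $\int_{(0,\infty)}(1\wedge t)\,\nu(dt)<\infty$. Let $(x,v)\in\mathbb{R}^2$ and let $\mathbb{P}^{(x,v)}$ be a probability measure under which $B$ is a one-dimensional Brownian motion with continuous paths started at $x$, $\sigma$ is a càdlàg strictly increasing process with stationary independent increments, $\sigma(0)=v$ and $\mathbb{E}^{(x,v)}[e^{-\lambda(\sigma(t)-\sigma(0))}]=e^{-t\phi(\lambda)}$ for all $t\ge 0$, $\lambda>0$, and $B$ and $\sigma$ are independent. Put $\sigma_0(u)=\sigma(u)-\sigma(0)$, $L(t)=\inf\{u\ge 0:\sigma(u)>t\}$, $H(t)=\sigma_0(L(t)-)$ (with $\sigma_0(0-)=\sigma_0(0)=0$), $X_{\mathrm e}(t)=B(H(t))$, $X(t)=e^{X_{\mathrm e}(t)}$, and let $\widetilde{\mathcal H}_t$ be the $\sigma$-algebra generated by $\{(X_{\mathrm e}(s),H(s)): 0\le s\le t\}$. Fix $T>0$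 and define on $\widetilde{\mathcal H}_T$ the measures $$\mathbb{Q}^{(x,v)}(A)=\mathbb{E}^{(x,v)}\Big[\mathbf 1_A\, e^{-\frac{X_{\mathrm e}(T)}{2}-\frac{H(T)}{8}}\Big],\qquad \widetilde{\mathbb{P}}^{(x,v)}(A)=e^{x/2}\,\mathbb{Q}^{(x,v)}(A).$$ Then $\widetilde{\mathbb{P}}^{(x,v)}$ is a probability measure, and the process $\{X(t),\ t\in[0,T]\}$ is a martingale with respect to $\{\widetilde{\mathcal H}_t\}_{t\in[0,T]}$ under $\widetilde{\mathbb{P}}^{(x,v)}$, and likewise under the finite measure $\mathbb{Q}^{(x,v)}$. -/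

import Mathlib

open MeasureTheory ProbabilityTheory Filter Topology Set
open scoped NNReal ENNReal

/-- `φ : (0, ∞) → [0, ∞)` is a Bernstein function: it is smooth and nonnegative on `(0, ∞)` and
`(-1) ^ (n - 1) φ⁽ⁿ⁾ ≥ 0` there for every `n ≥ 1` (written with `n + 1` in place of `n`).
Only the values of `φ` on `(0, ∞)` matter. -/
def IsBernstein (φ : ℝ → ℝ) : Prop :=
  ContDiffOn ℝ (⊤ : ℕ∞) φ (Ioi 0) ∧ (∀ l, 0 < l → 0 ≤ φ l) ∧
    ∀ (n : ℕ) (l : ℝ), 0 < l → 0 ≤ (-1) ^ n * iteratedDerivWithin (n + 1) φ (Ioi 0) l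

/-- `φ` is a Bernstein function whose Lévy triplet is `(0, 0, ν)` with `ν (0, ∞) = ∞`: no killing,
no drift, and a Lévy measure of infinite mass. The measure `ν` on `(0, ∞)` is represented by a
measure on `ℝ` carried by `(0, ∞)`. -/
def IsBernsteinZero (φ : ℝ → ℝ) : Prop :=
  IsBernstein φ ∧ ∃ ν : Measure ℝ, ν (Iic 0) = 0 ∧ ν (Ioi 0) = ∞ ∧
    (∫⁻ t, ENNReal.ofReal (min 1 t) ∂ν) < ∞ ∧
    ∀ l : ℝ, 0 < l → φ l = ∫ t, (1 - Real.exp (-(l * t))) ∂ν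

section

variable {Ω : Type*} {mΩ : MeasurableSpace Ω}

/-- Under `P`, the process `B` is a one-dimensional Brownian motion started at `x`
(all its paths are continuous). -/
structure IsBrownianFrom (x : ℝ) (B : ℝ≥0 → Ω → ℝ) (P : Measure Ω) : Prop where
  measurable : ∀ t, Measurable (B t)
  continuous_paths : ∀ ω, Continuous (fun t ↦ B t ω)
  brownian : IsBrownianReal (fun t ω ↦ B t ω - x) P

/-- Under `P`, the process `σ` is a subordinator with Laplace exponent `φ`, started at `v`:
a process with càdlàg paths and independent stationary increments, almost surely strictly
increasing, such that `σ 0 = v` almost surely and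
`E [exp (-l (σ t - σ 0))] = exp (-t φ l)`. (When `φ` has no drift it is a pure jump process.) -/
structure IsSubordinatorFrom (φ : ℝ → ℝ) (v : ℝ) (σ : ℝ≥0 → Ω → ℝ) (P : Measure Ω) : Prop where
  measurable : ∀ t, Measurable (σ t)
  right_continuous : ∀ ω t, ContinuousWithinAt (fun u ↦ σ u ω) (Ici t) t
  left_limits : ∀ ω t, ∃ y, Tendsto (fun u ↦ σ u ω) (𝓝[<] t) (𝓝 y)
  start : ∀ᵐ ω ∂P, σ 0 ω = v
  strictly_increasing : ∀ᵐ ω ∂P, StrictMono (fun t ↦ σ t ω)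
  indep_increments : HasIndepIncrements σ P
  stationary_increments : ∀ s t,
    IdentDistrib (fun ω ↦ σ (s + t) ω - σ s ω) (fun ω ↦ σ t ω - σ 0 ω) P P
  laplace : ∀ (t : ℝ≥0) (l : ℝ), 0 < l →
    ∫ ω, Real.exp (-(l * (σ t ω - σ 0 ω))) ∂P = Real.exp (-(t * φ l))

/-- The driving pair of the price model: under `P` (which plays the role of `P^(x,v)`), `B` is a
Brownian motion started at `x`, `σ` is a subordinator with Laplace exponent `φ` started at `v`,
and the processes `B` and `σ` are independent. -/
structure IsDrivingPair (φ : ℝ → ℝ) (x v : ℝ) (B σ : ℝ≥0 → Ω → ℝ) (P : Measure Ω) : Prop where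
  brownian : IsBrownianFrom x B P
  subordinator : IsSubordinatorFrom φ v σ P
  indep : IndepFun (fun ω t ↦ B t ω) (fun ω t ↦ σ t ω) P

/-- The inverse process `L(t) = inf {u ≥ 0 : σ(u) > t}`. -/
noncomputable def inverseProcess (σ : ℝ≥0 → Ω → ℝ) (t : ℝ≥0) (ω : Ω) : ℝ≥0 :=
  sInf {u : ℝ≥0 | (t : ℝ) < σ u ω}

/-- The undershooting `H(t) = σ₀(L(t)-)`, where `σ₀(u) = σ(u) - σ(0)`. At `L(t) = 0` the left
limit is read as `σ₀(0-) = σ₀(0) = 0`. -/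
noncomputable def undershoot (σ : ℝ≥0 → Ω → ℝ) (t : ℝ≥0) (ω : Ω) : ℝ :=
  Function.leftLim (fun u ↦ σ u ω - σ 0 ω) (inverseProcess σ t ω)

/-- The log-price `Xₑ(t) = B(H(t))`; `H(t) ≥ 0` almost surely. -/
noncomputable def logPrice (B σ : ℝ≥0 → Ω → ℝ) (t : ℝ≥0) (ω : Ω) : ℝ :=
  B (undershoot σ t ω).toNNReal ω

/-- The price `X(t) = exp (Xₑ(t))`. -/
noncomputable def price (B σ : ℝ≥0 → Ω → ℝ) (t : ℝ≥0) (ω : Ω) : ℝ :=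
  Real.exp (logPrice B σ t ω)

/-- The σ-algebra generated by `(Xₑ(s), H(s))`, `0 ≤ s ≤ t`. -/
@[reducible] noncomputable def history (B σ : ℝ≥0 → Ω → ℝ) (t : ℝ≥0) : MeasurableSpace Ω :=
  ⨆ s : Iic t, MeasurableSpace.comap
    (fun ω ↦ (logPrice B σ (s : ℝ≥0) ω, undershoot σ (s : ℝ≥0) ω)) inferInstance

theorem history_mono (B σ : ℝ≥0 → Ω → ℝ) {s t : ℝ≥0} (h : s ≤ t) :
    history B σ s ≤ history B σ t :=
  iSup_le fun r ↦ le_iSup (fun s : Iic t ↦ MeasurableSpace.comap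
    (fun ω ↦ (logPrice B σ (s : ℝ≥0) ω, undershoot σ (s : ℝ≥0) ω)) inferInstance)
    ⟨r.1, le_trans r.2 h⟩

/-- The natural filtration of `(Xₑ, H)` with time set `[0, T]`, as a filtration of the σ-algebra
that it has reached at time `T`. -/
noncomputable def historyFiltration (B σ : ℝ≥0 → Ω → ℝ) (T : ℝ≥0) : Filtration (Iic T) (history B σ T) where
  seq t := history B σ t
  mono' _ _ h := history_mono B σ h
  le' t := history_mono B σ t.2

theorem measurable_inverseProcess {σ : ℝ≥0 → Ω → ℝ} (hm : ∀ t, Measurable (σ t))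
    (hr : ∀ ω t, ContinuousWithinAt (fun u ↦ σ u ω) (Ici t) t) (t : ℝ≥0) :
    Measurable (inverseProcess σ t) := by
  obtain ⟨D, hDc, hDd⟩ := TopologicalSpace.exists_countable_dense ℝ≥0
  -- a strict upper crossing before time `u` also happens at a time in `D` before `u`
  have key : ∀ ω r u, (t : ℝ) < σ r ω → r < u → ∃ q ∈ D, q < u ∧ (t : ℝ) < σ q ω := by
    intro ω r u h hu
    have h1 : ∀ᶠ q in 𝓝[>] r, (t : ℝ) < σ q ω :=
      ((hr ω r).mono Ioi_subset_Ici_self).eventually (lt_mem_nhds h)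
    obtain ⟨c, hc, hcs⟩ := (mem_nhdsGT_iff_exists_Ioo_subset' hu).1
      (inter_mem h1 (Ioo_mem_nhdsGT hu))
    obtain ⟨q, hqD, hq⟩ := hDd.exists_between hc
    exact ⟨q, hqD, (hcs hq).2.2, (hcs hq).1⟩
  refine measurable_of_Iio fun u ↦ ?_
  rcases eq_or_ne u 0 with rfl | hu
  · simp
  have hset : inverseProcess σ t ⁻¹' Iio u =
      (⋂ q ∈ D, {ω | σ q ω ≤ t}) ∪ ⋃ q ∈ D ∩ Iio u, {ω | (t : ℝ) < σ q ω} := by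
    ext ω
    simp only [mem_preimage, mem_Iio, mem_union, mem_iInter, mem_iUnion, mem_ofPred_eq,
      inverseProcess]
    rcases eq_empty_or_nonempty {u : ℝ≥0 | (t : ℝ) < σ u ω} with he | hne
    · rw [he]
      have : ∀ q, σ q ω ≤ t := fun q ↦ not_lt.1 fun hq ↦ (eq_empty_iff_forall_notMem.1 he q) hq
      simp [this, pos_iff_ne_zero, hu]
    · rw [csInf_lt_iff (OrderBot.bddBelow _) hne]
      constructor
      · rintro ⟨r, hr', hru⟩
        obtain ⟨q, hqD, hqu, hq⟩ := key ω r u hr' hru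
        exact Or.inr ⟨q, ⟨hqD, hqu⟩, hq⟩
      · rintro (h | ⟨q, ⟨hqD, hqu⟩, hq⟩)
        · obtain ⟨r, hr'⟩ := hne
          obtain ⟨q, hqD, -, hq⟩ := key ω r (r + 1) hr' (by simp)
          exact absurd (h q hqD) (not_le.2 hq)
        · exact ⟨q, hq, hqu⟩
  rw [hset]
  refine (MeasurableSet.biInter hDc fun q _ ↦ measurableSet_le (hm q) measurable_const).union
    (MeasurableSet.biUnion (hDc.mono inter_subset_left) fun q _ ↦
      measurableSet_lt measurable_const (hm q))

theorem measurable_eval_nat {σ : ℝ≥0 → Ω → ℝ} (hm : ∀ t, Measurable (σ t)) (f : ℕ → ℝ≥0)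
    {K : Ω → ℕ} (hK : Measurable K) : Measurable fun ω ↦ σ (f (K ω)) ω := by
  have hp : Measurable fun p : Ω × ℕ ↦ σ (f p.2) p.1 :=
    measurable_from_prod_countable_left fun m ↦ hm (f m)
  have hk : Measurable fun ω ↦ (ω, K ω) := measurable_id.prodMk hK
  have := hp.comp hk
  simpa only [Function.comp_def] using this

theorem measurable_undershoot {σ : ℝ≥0 → Ω → ℝ} (hm : ∀ t, Measurable (σ t))
    (hr : ∀ ω t, ContinuousWithinAt (fun u ↦ σ u ω) (Ici t) t)
    (hl : ∀ ω t, ∃ y, Tendsto (fun u ↦ σ u ω) (𝓝[<] t) (𝓝 y)) (t : ℝ≥0) :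
    Measurable (undershoot σ t) := by
  have hL := measurable_inverseProcess hm hr t
  -- grid points strictly to the left of `a`, converging to `a` (constantly `0` when `a = 0`)
  let k : ℕ → ℝ≥0 → ℕ := fun n a ↦ ⌈a * ((n : ℝ≥0) + 1)⌉₊ - 1
  let g : ℕ → ℝ≥0 → ℝ≥0 := fun n a ↦ (k n a : ℝ≥0) / ((n : ℝ≥0) + 1)
  have hpos : ∀ n : ℕ, (0 : ℝ≥0) < (n : ℝ≥0) + 1 := fun n ↦ by positivity
  have hlt : ∀ n a, 0 < a → g n a < a := by
    intro n a ha
    rw [div_lt_iff₀ (hpos n)]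
    have h0 : 0 < ⌈a * ((n : ℝ≥0) + 1)⌉₊ := Nat.ceil_pos.2 (mul_pos ha (hpos n))
    exact Nat.lt_ceil.1 (Nat.sub_lt h0 one_pos)
  have hge : ∀ (n : ℕ) (a : ℝ≥0), (a : ℝ) - 1 / ((n : ℝ) + 1) ≤ g n a := by
    intro n a
    have h1 : (a * ((n : ℝ≥0) + 1) : ℝ≥0) ≤ (k n a : ℝ≥0) + 1 := by
      refine (Nat.le_ceil _).trans ?_
      have : ⌈a * ((n : ℝ≥0) + 1)⌉₊ ≤ k n a + 1 := by simp only [k]; omega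
      exact_mod_cast this
    have h2 : (a : ℝ) * ((n : ℝ) + 1) ≤ (k n a : ℝ) + 1 := by exact_mod_cast h1
    have h3 : (0 : ℝ) < (n : ℝ) + 1 := by positivity
    have h4 : ((g n a : ℝ≥0) : ℝ) = (k n a : ℝ) / ((n : ℝ) + 1) := by simp [g]
    rw [h4, sub_le_iff_le_add, ← add_div, le_div_iff₀ h3]
    exact h2
  have hgt : ∀ a, 0 < a → Tendsto (fun n ↦ g n a) atTop (𝓝[<] a) := by
    intro a ha
    refine tendsto_nhdsWithin_iff.2 ⟨?_, Eventually.of_forall fun n ↦ hlt n a ha⟩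
    rw [← NNReal.tendsto_coe]
    refine tendsto_of_tendsto_of_tendsto_of_le_of_le ?_ tendsto_const_nhds
      (fun n ↦ hge n a) (fun n ↦ (NNReal.coe_lt_coe.2 (hlt n a ha)).le)
    simpa using (tendsto_const_nhds (x := (a : ℝ))).sub
      (tendsto_one_div_add_atTop_nhds_zero_nat (𝕜 := ℝ))
  refine measurable_of_tendsto_metrizable
    (f := fun n ω ↦ σ (g n (inverseProcess σ t ω)) ω - σ 0 ω) (fun n ↦ ?_)
    (tendsto_pi_nhds.2 fun ω ↦ ?_)
  · refine Measurable.sub ?_ (hm 0)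
    have hk : Measurable fun ω ↦ k n (inverseProcess σ t ω) :=
      (measurable_from_nat (f := fun m ↦ m - 1)).comp
        (Nat.measurable_ceil.comp (hL.mul_const _))
    exact measurable_eval_nat hm (fun m ↦ (m : ℝ≥0) / ((n : ℝ≥0) + 1)) hk
  · rcases eq_or_ne (inverseProcess σ t ω) 0 with h0 | h0
    · have e1 : undershoot σ t ω = 0 := by
        rw [undershoot, h0, leftLim_eq_of_isBot (a := (0 : ℝ≥0)) (fun _ ↦ bot_le)]
        simp
      have e2 : ∀ n, g n (inverseProcess σ t ω) = 0 := fun n ↦ by simp [g, k, h0]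
      simp [e1, e2]
    · obtain ⟨y, hy⟩ := hl ω (inverseProcess σ t ω)
      have hy' : Tendsto (fun u ↦ σ u ω - σ 0 ω) (𝓝[<] (inverseProcess σ t ω))
          (𝓝 (y - σ 0 ω)) := hy.sub_const _
      have hh := tendsto_leftLim_of_tendsto ⟨_, hy'⟩
      exact hh.comp (hgt _ (pos_iff_ne_zero.2 h0))

theorem measurable_logPrice {B σ : ℝ≥0 → Ω → ℝ} (hB : ∀ t, Measurable (B t))
    (hc : ∀ ω, Continuous (fun t ↦ B t ω)) (hm : ∀ t, Measurable (σ t))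
    (hr : ∀ ω t, ContinuousWithinAt (fun u ↦ σ u ω) (Ici t) t)
    (hl : ∀ ω t, ∃ y, Tendsto (fun u ↦ σ u ω) (𝓝[<] t) (𝓝 y)) (t : ℝ≥0) :
    Measurable (logPrice B σ t) :=
  (measurable_uncurry_of_continuous_of_measurable (u := B) hc hB).comp
    ((measurable_undershoot hm hr hl t).real_toNNReal.prodMk measurable_id)

theorem IsDrivingPair.history_le {φ : ℝ → ℝ} {x v : ℝ} {B σ : ℝ≥0 → Ω → ℝ} {P : Measure Ω}
    (h : IsDrivingPair φ x v B σ P) (t : ℝ≥0) : history B σ t ≤ mΩ :=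
  iSup_le fun s ↦ Measurable.comap_le <|
    (measurable_logPrice h.brownian.measurable h.brownian.continuous_paths
      h.subordinator.measurable h.subordinator.right_continuous h.subordinator.left_limits
      s).prodMk
    (measurable_undershoot h.subordinator.measurable h.subordinator.right_continuous
      h.subordinator.left_limits s)

/-- The measure `A ↦ E [1_A exp (-Xₑ(T)/2 - H(T)/8)]` on the σ-algebra generated by
`(Xₑ(s), H(s))`, `s ≤ T`. -/
noncomputable def tiltedMeasure {φ : ℝ → ℝ} {x v : ℝ} {B σ : ℝ≥0 → Ω → ℝ} {P : Measure Ω}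
    (h : IsDrivingPair φ x v B σ P) (T : ℝ≥0) : @Measure Ω (history B σ T) :=
  (P.withDensity fun ω ↦
    ENNReal.ofReal (Real.exp (-(logPrice B σ T ω) / 2 - undershoot σ T ω / 8))).trim
    (h.history_le T)

/-- The same measure with its total mass `exp (-x/2)` normalized to one, that is, the measure with
density `exp (-(Xₑ(T) - x)/2 - H(T)/8)`. For `x = 0` it is `tiltedMeasure`. -/
noncomputable def pricingMeasure {φ : ℝ → ℝ} {x v : ℝ} {B σ : ℝ≥0 → Ω → ℝ} {P : Measure Ω}
    (h : IsDrivingPair φ x v B σ P) (T : ℝ≥0) : @Measure Ω (history B σ T) :=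
  ENNReal.ofReal (Real.exp (x / 2)) • tiltedMeasure h T

end

/-! Independence lets the clock be frozen: conditionally on `σ`, the times a = H(s) ≤ b = H(t) ≤ c =
H(T) are constants and only Brownian motion is random. The weight exp(-B_c/2 - c/8) is designed for
this. Averaging the increment B_c - B_b turns exp(B_b) times the weight into exp(B_b/2 - b/8), which
is itself an exponential martingale. The mean over an event of the past at a is therefore that of
exp(B_a/2 - a/8), which involves neither t nor T (`lintegral_mul_exp_tilt`,
`setLIntegral_price_mul`). The total mass is the exponential martingale with θ = -1/2.

An event of the history depends on both `B` and `σ`. `exists_section` writes it as the diagonal of a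
set in Ω × Ω whose sections at a frozen clock lie in the past of `B` at H(s). This rests on H being
increasing, which in turn needs `σ` to be unbounded, hence φ(1) > 0. Working with `lintegral` avoids
integrability conditions until the end. -/

/-! ### Exponential martingales of Brownian motion at deterministic times. -/

section BrownianTilt

variable {Ω : Type*} {mΩ : MeasurableSpace Ω} {P : Measure Ω} {x : ℝ} {B : ℝ≥0 → Ω → ℝ}

/-- The σ-algebra generated by the process `B` up to time `a`. -/
@[reducible] def processPast (B : ℝ≥0 → Ω → ℝ) (a : ℝ≥0) : MeasurableSpace Ω :=
  MeasurableSpace.comap (fun ω (t : Iic a) ↦ B t ω) inferInstance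

theorem measurable_processPast {a b : ℝ≥0} (h : b ≤ a) : Measurable[processPast B a] (B b) :=
  (measurable_pi_apply (⟨b, h⟩ : Iic a)).comp (comap_measurable fun ω (t : Iic a) ↦ B t ω)

theorem processPast_mono {a b : ℝ≥0} (h : a ≤ b) : processPast B a ≤ processPast B b := by
  rw [processPast, ← measurable_iff_comap_le]
  exact @measurable_pi_lambda _ _ _ (_) _ _ fun t ↦ measurable_processPast (t.2.trans h)

theorem processPast_le (hB : ∀ t, Measurable (B t)) (a : ℝ≥0) : processPast B a ≤ mΩ :=
  Measurable.comap_le (measurable_pi_lambda _ fun _ ↦ hB _)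

/-- The increment after `a` is independent of the past at `a` and is centred Gaussian with variance
`b - a`, so its exponential moment factors out. -/
theorem IsBrownianFrom.lintegral_mul_exp_increment (hB : IsBrownianFrom x B P) {a b : ℝ≥0}
    (hab : a ≤ b) {f : Ω → ℝ≥0∞} (hf : Measurable[processPast B a] f) (θ : ℝ) :
    ∫⁻ ω, f ω * ENNReal.ofReal (Real.exp (θ * (B b ω - B a ω))) ∂P =
      (∫⁻ ω, f ω ∂P) * ENNReal.ofReal (Real.exp (θ ^ 2 * (b - a) / 2)) := by
  have hW := hB.brownian.toIsPreBrownianReal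
  have := hW.isGaussianProcess.isProbabilityMeasure
  have hWm : ∀ t, Measurable fun ω ↦ B t ω - x := fun t ↦ (hB.measurable t).sub_const x
  have hle : processPast B a ≤ processPast (fun t ω ↦ B t ω - x) a := by
    rw [processPast, ← measurable_iff_comap_le]
    refine @measurable_pi_lambda _ _ _ (_) _ _ fun t ↦ ?_
    have := (measurable_processPast (B := fun t ω ↦ B t ω - x) t.2).add_const x
    simpa using this
  have hinc : Measurable[MeasurableSpace.comap
      (fun ω t ↦ (B (a + t) ω - x) - (B a ω - x)) inferInstance]
      fun ω ↦ ENNReal.ofReal (Real.exp (θ * (B b ω - B a ω))) := by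
    have h1 : Measurable[MeasurableSpace.comap
      (fun ω t ↦ (B (a + t) ω - x) - (B a ω - x)) inferInstance]
      (fun ω ↦ (B (a + (b - a)) ω - x) - (B a ω - x)) :=
      (measurable_pi_apply (b - a)).comp
        (comap_measurable fun ω t ↦ (B (a + t) ω - x) - (B a ω - x))
    rw [add_tsub_cancel_of_le hab] at h1
    simp only [sub_sub_sub_cancel_right] at h1
    exact (Real.measurable_exp.comp (h1.const_mul θ)).ennreal_ofReal
  have hind := (hW.indepFun_shift a).symm
  rw [lintegral_mul_eq_lintegral_mul_lintegral_of_independent_measurableSpace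
    (processPast_le hWm a)
    (Measurable.comap_le (measurable_pi_lambda _ fun _ ↦ (hWm _).sub (hWm _)))
    hind (hf.mono hle le_rfl) hinc]
  congr 1
  have hlaw := (hW.hasLaw_sub b a).map_eq
  have hmgf := mgf_gaussianReal hlaw θ
  have hint : Integrable (fun ω ↦ Real.exp (θ * (B b ω - B a ω))) P := by
    have h0 : Integrable (fun y ↦ Real.exp (θ * y)) (P.map ((fun ω ↦ B b ω - x) - fun ω ↦ B a ω - x)) := by
      rw [hlaw]; exact integrable_exp_mul_gaussianReal θ
    have h1 := h0.comp_measurable ((hWm b).sub (hWm a))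
    simpa [Function.comp_def] using h1
  rw [← ofReal_integral_eq_lintegral_ofReal hint (Eventually.of_forall fun _ ↦ (Real.exp_pos _).le)]
  congr 1
  have hd : ((nndist b.1 a.1 : ℝ≥0) : ℝ) = b - a := by
    rw [coe_nndist, Real.dist_eq]
    exact abs_of_nonneg (sub_nonneg.2 (NNReal.coe_le_coe.2 hab))
  simp only [mgf, Pi.sub_apply, sub_sub_sub_cancel_right, hd] at hmgf
  rw [hmgf]
  congr 1
  ring

theorem IsBrownianFrom.eval_zero (hB : IsBrownianFrom x B P) : ∀ᵐ ω ∂P, B 0 ω = x := by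
  filter_upwards [hB.brownian.eval_zero_ae_eq_zero] with ω h
  linarith

theorem IsBrownianFrom.lintegral_exp_mul [IsProbabilityMeasure P] (hB : IsBrownianFrom x B P)
    (c : ℝ≥0) (θ : ℝ) :
    ∫⁻ ω, ENNReal.ofReal (Real.exp (θ * B c ω - θ ^ 2 * c / 2)) ∂P =
      ENNReal.ofReal (Real.exp (θ * x)) := by
  -- A constant factor is enough at time 0, because `B 0 = x` almost surely.
  have h := hB.lintegral_mul_exp_increment (zero_le (a := c))
    (f := fun _ ↦ ENNReal.ofReal (Real.exp (θ * x - θ ^ 2 * c / 2))) measurable_const θ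
  have e : ∫⁻ ω, ENNReal.ofReal (Real.exp (θ * B c ω - θ ^ 2 * c / 2)) ∂P =
      ∫⁻ ω, ENNReal.ofReal (Real.exp (θ * x - θ ^ 2 * c / 2)) *
        ENNReal.ofReal (Real.exp (θ * (B c ω - B 0 ω))) ∂P := by
    refine lintegral_congr_ae ?_
    filter_upwards [hB.eval_zero] with ω hω
    rw [← ENNReal.ofReal_mul (Real.exp_pos _).le, ← Real.exp_add, hω]
    congr 2
    ring
  rw [e, h, lintegral_const, measure_univ, mul_one, ← ENNReal.ofReal_mul (Real.exp_pos _).le,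
    ← Real.exp_add]
  congr 2
  simp

/-- Under the density `exp (-B c / 2 - c / 8)`, the process `exp B` is a martingale up to time
`c`: its mean on an event of the past at time `a` does not depend on the later time `b`. -/
theorem IsBrownianFrom.lintegral_mul_exp_tilt (hB : IsBrownianFrom x B P) {a b c : ℝ≥0}
    (hab : a ≤ b) (hbc : b ≤ c) {f : Ω → ℝ≥0∞} (hf : Measurable[processPast B a] f) :
    ∫⁻ ω, f ω * (ENNReal.ofReal (Real.exp (B b ω)) *
      ENNReal.ofReal (Real.exp (-(B c ω) / 2 - c / 8))) ∂P =
    ∫⁻ ω, f ω * ENNReal.ofReal (Real.exp (B a ω / 2 - a / 8)) ∂P := by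
  have hexp : ∀ {u v : ℝ≥0} (k : ℝ), u ≤ v → Measurable[processPast B v]
      fun ω ↦ ENNReal.ofReal (Real.exp (B u ω / 2 + k)) := fun k h ↦
    (Real.measurable_exp.comp
      (((measurable_processPast h).div_const 2).add_const k)).ennreal_ofReal
  -- The increment from `b` to `c` enters with coefficient -1/2 and contributes exp((c - b)/8),
  -- which replaces -c/8 by -b/8. Next, the increment from `a` to `b` enters with coefficient 1/2
  -- and replaces -b/8 by -a/8.
  have h1 := hB.lintegral_mul_exp_increment hbc
    ((hf.mono (processPast_mono hab) le_rfl).mul (hexp (-(c : ℝ) / 8) le_rfl)) (-1 / 2)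
  have h2 := hB.lintegral_mul_exp_increment hab (hf.mul (hexp (-(b : ℝ) / 8) le_rfl)) (1 / 2)
  simp only [Pi.mul_apply] at h1 h2
  have hp := fun y : ℝ ↦ (Real.exp_pos y).le
  calc _ = ∫⁻ ω, f ω * ENNReal.ofReal (Real.exp (B b ω / 2 + -(c : ℝ) / 8)) *
        ENNReal.ofReal (Real.exp (-1 / 2 * (B c ω - B b ω))) ∂P := by
        refine lintegral_congr fun ω ↦ ?_
        rw [mul_assoc, ← ENNReal.ofReal_mul (hp _), ← ENNReal.ofReal_mul (hp _), ← Real.exp_add,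
          ← Real.exp_add]
        congr 3; ring
    _ = ∫⁻ ω, f ω * ENNReal.ofReal (Real.exp (B a ω / 2 + -(b : ℝ) / 8)) *
        ENNReal.ofReal (Real.exp (1 / 2 * (B b ω - B a ω))) ∂P := by
        rw [h1, ← lintegral_mul_const' _ _ ENNReal.ofReal_ne_top]
        refine lintegral_congr fun ω ↦ ?_
        rw [mul_assoc, mul_assoc, ← ENNReal.ofReal_mul (hp _), ← ENNReal.ofReal_mul (hp _),
          ← Real.exp_add, ← Real.exp_add]
        congr 3; ring
    _ = _ := by
        rw [h2, ← lintegral_mul_const' _ _ ENNReal.ofReal_ne_top]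
        refine lintegral_congr fun ω ↦ ?_
        rw [mul_assoc, ← ENNReal.ofReal_mul (hp _), ← Real.exp_add]
        congr 3; ring

end BrownianTilt

/-! ### Decoupling of independent sources of randomness. -/

theorem lintegral_comp_of_indepFun {Ω Ω₁ Ω₂ : Type*} {mΩ : MeasurableSpace Ω}
    {m₁ : MeasurableSpace Ω₁} {m₂ : MeasurableSpace Ω₂} {P : Measure Ω} [IsProbabilityMeasure P]
    {F : Ω → Ω₁} {G : Ω → Ω₂} (hF : Measurable F) (hG : Measurable G) (h : IndepFun F G P)
    {g : Ω₁ × Ω₂ → ℝ≥0∞} (hg : Measurable g) :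
    ∫⁻ ω, g (F ω, G ω) ∂P = ∫⁻ ω', ∫⁻ ω, g (F ω, G ω') ∂P ∂P := by
  rw [← lintegral_map hg (hF.prodMk hG),
    (indepFun_iff_map_prod_eq_prod_map_map hF.aemeasurable hG.aemeasurable).1 h,
    lintegral_prod_symm' _ hg, lintegral_map hg.lintegral_prod_left' hG]
  exact lintegral_congr fun ω' ↦ lintegral_map (hg.comp measurable_prodMk_right) hF

/-- The identity, viewed once as a map into (Ω, m₁) and once into (Ω, m₂), gives two independent
variables. Decoupling thus takes place on Ω × Ω, and no functional has to be rewritten on path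
space. -/
theorem lintegral_diag_of_indep {Ω : Type*} {m₁ m₂ mΩ : MeasurableSpace Ω} {P : Measure Ω}
    [hP : IsProbabilityMeasure P] (h₁ : m₁ ≤ mΩ) (h₂ : m₂ ≤ mΩ) (h : Indep m₁ m₂ P)
    {g : Ω × Ω → ℝ≥0∞} (hg : Measurable[m₁.prod m₂] g) :
    ∫⁻ ω, g (ω, ω) ∂P = ∫⁻ ω', ∫⁻ ω, g (ω, ω') ∂P ∂P := by
  refine @lintegral_comp_of_indepFun Ω Ω Ω mΩ m₁ m₂ P hP id id (measurable_id'' h₁)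
    (measurable_id'' h₂) ?_ g hg
  have h' : Indep (m₁.comap id) (m₂.comap id) P := by simpa only [MeasurableSpace.comap_id] using h
  exact h'

/-! ### Positivity of the Laplace exponent and monotonicity of the clock. -/

/-- The integrand is positive on (0, ∞), is dominated by 1 ∧ t, and `ν` is nonzero. The infinite
mass of `ν` serves only to make it nonzero. -/
theorem IsBernsteinZero.apply_one_pos {φ : ℝ → ℝ} (hφ : IsBernsteinZero φ) : 0 < φ 1 := by
  obtain ⟨-, ν, h0, hinf, hfin, hrep⟩ := hφ
  have hpos : ∀ᵐ t ∂ν, 0 < t := by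
    rw [ae_iff]
    simp only [not_lt]
    exact h0
  rw [hrep 1 one_pos]
  simp only [one_mul]
  have hint : Integrable (fun t : ℝ ↦ 1 - Real.exp (-t)) ν := by
    refine ⟨by fun_prop, lt_of_le_of_lt (lintegral_mono_ae ?_) hfin⟩
    filter_upwards [hpos] with t ht
    have h1 : 0 ≤ 1 - Real.exp (-t) := by simpa using ht.le
    rw [Real.enorm_of_nonneg h1]
    refine ENNReal.ofReal_le_ofReal (le_min ?_ ?_)
    · linarith [Real.exp_pos (-t)]
    · linarith [Real.add_one_le_exp (-t)]
  rw [integral_pos_iff_support_of_nonneg_ae ?_ hint]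
  · refine lt_of_lt_of_le (by simp [hinf] : 0 < ν (Ioi 0)) (measure_mono fun t ht ↦ ?_)
    have : Real.exp (-t) < 1 := by simpa using ht
    simpa [Function.mem_support, sub_eq_zero] using this.ne'
  · filter_upwards [hpos] with t ht
    simpa using ht.le

section Paths

variable {Ω : Type*} {mΩ : MeasurableSpace Ω}

/-- On the event that the path stays within `M` of its start, exp(-(σ(n) - σ(0))) ≥ exp(-M) for
every n, while its mean exp(-n φ(1)) tends to 0. Markov's inequality makes the event null. -/
theorem IsSubordinatorFrom.ae_unbounded {P : Measure Ω} [IsProbabilityMeasure P] {φ : ℝ → ℝ}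
    (hφ : 0 < φ 1) {v : ℝ} {σ : ℝ≥0 → Ω → ℝ} (hσ : IsSubordinatorFrom φ v σ P) :
    ∀ᵐ ω ∂P, ∀ M : ℝ, ∃ u, M < σ u ω := by
  have key : ∀ M : ℕ, ∀ᵐ ω ∂P, ∃ u, (M : ℝ) < σ u ω - σ 0 ω := by
    intro M
    have hle : ∀ n : ℕ, Real.exp (-M) * P.real {ω | ∀ u, σ u ω - σ 0 ω ≤ M} ≤
        Real.exp (-(n * φ 1)) := by
      intro n
      have hl := hσ.laplace n 1 one_pos
      simp only [one_mul, NNReal.coe_natCast] at hl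
      have hint : Integrable (fun ω ↦ Real.exp (-(σ n ω - σ 0 ω))) P := by
        -- A non-integrable function would have integral 0 by convention, whereas the Laplace
        -- transform is positive.
        by_contra hni
        rw [integral_undef hni] at hl
        exact (Real.exp_pos _).ne hl
      rw [← hl]
      refine le_trans ?_ (mul_meas_ge_le_integral_of_nonneg
        (Eventually.of_forall fun _ ↦ (Real.exp_pos _).le) hint (Real.exp (-M)))
      refine mul_le_mul_of_nonneg_left (measureReal_mono fun ω hω ↦ ?_) (Real.exp_pos _).le
      exact Real.exp_le_exp.2 (neg_le_neg (hω n))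
    have hlim : Tendsto (fun n : ℕ ↦ Real.exp (-(n * φ 1))) atTop (𝓝 0) :=
      Real.tendsto_exp_neg_atTop_nhds_zero.comp
        (tendsto_natCast_atTop_atTop.atTop_mul_const hφ)
    have h0 := ge_of_tendsto' hlim hle
    have h1 : P.real {ω | ∀ u, σ u ω - σ 0 ω ≤ M} = 0 :=
      le_antisymm (nonpos_of_mul_nonpos_right h0 (Real.exp_pos _)) measureReal_nonneg
    rw [measureReal_eq_zero_iff] at h1
    rw [ae_iff]
    simpa only [not_exists, not_lt] using h1
  filter_upwards [ae_all_iff.2 key] with ω hω M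
  obtain ⟨n, hn⟩ := exists_nat_gt (M - σ 0 ω)
  obtain ⟨u, hu⟩ := hω n
  exact ⟨u, by linarith⟩

theorem undershoot_nonneg {σ : ℝ≥0 → Ω → ℝ} {ω : Ω} (hm : Monotone fun u ↦ σ u ω) (t : ℝ≥0) :
    0 ≤ undershoot σ t ω := by
  have hm' : Monotone fun u ↦ σ u ω - σ 0 ω := fun a b hab ↦ sub_le_sub_right (hm hab) _
  have h := hm'.leftLim (zero_le (a := inverseProcess σ t ω))
  rw [leftLim_eq_of_isBot (a := (0 : ℝ≥0)) (fun _ ↦ bot_le)] at h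
  simpa [undershoot] using h

/-- Unboundedness matters because `sInf ∅ = 0` in `ℝ≥0`: past the supremum of a bounded path, the
inverse would drop back to 0. -/
theorem undershoot_mono {σ : ℝ≥0 → Ω → ℝ} {ω : Ω} (hm : Monotone fun u ↦ σ u ω)
    (hu : ∀ M : ℝ, ∃ u, M < σ u ω) : Monotone fun t ↦ undershoot σ t ω := by
  intro s t hst
  have hm' : Monotone fun u ↦ σ u ω - σ 0 ω := fun a b hab ↦ sub_le_sub_right (hm hab) _
  refine hm'.leftLim (csInf_le_csInf (OrderBot.bddBelow _) (hu t) fun u hut ↦ ?_)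
  exact lt_of_le_of_lt (NNReal.coe_le_coe.2 hst) hut

end Paths

/-! ### Transfer to the random clock. -/

section TimeChange

variable {Ω : Type*} {mΩ : MeasurableSpace Ω} {P : Measure Ω} {φ : ℝ → ℝ} {x v : ℝ}
  {B σ : ℝ≥0 → Ω → ℝ}

/-- The σ-algebra generated by the whole process `B`. -/
@[reducible] def processSpace (B : ℝ≥0 → Ω → ℝ) : MeasurableSpace Ω :=
  MeasurableSpace.comap (fun ω t ↦ B t ω) inferInstance

theorem measurable_processSpace (B : ℝ≥0 → Ω → ℝ) (t : ℝ≥0) : Measurable[processSpace B] (B t) :=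
  (measurable_pi_apply t).comp (comap_measurable fun ω t ↦ B t ω)

theorem processSpace_le (hB : ∀ t, Measurable (B t)) : processSpace B ≤ mΩ :=
  Measurable.comap_le (measurable_pi_lambda _ hB)

/-- The log-price when the Brownian path and the clock are taken at different sample points. -/
noncomputable def decoupledLogPrice (B σ : ℝ≥0 → Ω → ℝ) (t : ℝ≥0) (p : Ω × Ω) : ℝ :=
  B (undershoot σ t p.2).toNNReal p.1

theorem IsSubordinatorFrom.measurable_undershoot_processSpace (hσ : IsSubordinatorFrom φ v σ P)
    (t : ℝ≥0) : Measurable[processSpace σ] (undershoot σ t) :=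
  @measurable_undershoot Ω (processSpace σ) σ (measurable_processSpace σ) hσ.right_continuous
    hσ.left_limits t

theorem IsDrivingPair.measurable_undershoot_snd (h : IsDrivingPair φ x v B σ P) (t : ℝ≥0) :
    Measurable[(processSpace B).prod (processSpace σ)] fun p : Ω × Ω ↦ undershoot σ t p.2 :=
  (h.subordinator.measurable_undershoot_processSpace t).comp
    (@measurable_snd Ω Ω (processSpace B) (processSpace σ))

theorem IsDrivingPair.measurable_decoupledLogPrice (h : IsDrivingPair φ x v B σ P) (t : ℝ≥0) :
    Measurable[(processSpace B).prod (processSpace σ)] (decoupledLogPrice B σ t) :=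
  have hu : Measurable[(inferInstance : MeasurableSpace ℝ≥0).prod (processSpace B)]
      (Function.uncurry B) :=
    @measurable_uncurry_of_continuous_of_measurable Ω ℝ ℝ≥0 _ _ _ _ _ _ _ _ _ (processSpace B) B
      h.brownian.continuous_paths (measurable_processSpace B)
  hu.comp (@Measurable.prodMk (Ω × Ω) ((processSpace B).prod (processSpace σ)) ℝ≥0 Ω
    inferInstance (processSpace B) _ _ (h.measurable_undershoot_snd t).real_toNNReal
    (@measurable_fst Ω Ω (processSpace B) (processSpace σ)))

theorem IsDrivingPair.lintegral_decouple [IsProbabilityMeasure P] (h : IsDrivingPair φ x v B σ P)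
    {g : Ω × Ω → ℝ≥0∞} (hg : Measurable[(processSpace B).prod (processSpace σ)] g) :
    ∫⁻ ω, g (ω, ω) ∂P = ∫⁻ ω', ∫⁻ ω, g (ω, ω') ∂P ∂P :=
  lintegral_diag_of_indep (processSpace_le h.brownian.measurable)
    (processSpace_le h.subordinator.measurable) h.indep hg

/-- Every event of the history at time `s` is the diagonal of a measurable set of the product
space, whose sections at a fixed clock with increasing undershoot belong to the past of `B` at the
time shown by the clock. -/
theorem IsDrivingPair.exists_section (h : IsDrivingPair φ x v B σ P) {s : ℝ≥0} {A : Set Ω}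
    (hA : MeasurableSet[history B σ s] A) :
    ∃ E : Set (Ω × Ω), MeasurableSet[(processSpace B).prod (processSpace σ)] E ∧
      (∀ ω, (ω, ω) ∈ E ↔ ω ∈ A) ∧
      ∀ ω', Monotone (fun t ↦ undershoot σ t ω') →
        MeasurableSet[processPast B (undershoot σ s ω').toNNReal] {ω | (ω, ω') ∈ E} := by
  -- The decoupled version of the history: its pullback along the diagonal is the history itself,
  -- and its pullback along ω ↦ (ω, ω') is the history seen with the clock frozen at ω'.
  let 𝒢 : MeasurableSpace (Ω × Ω) := ⨆ r : Iic s, MeasurableSpace.comap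
    (fun p ↦ (decoupledLogPrice B σ r p, undershoot σ r p.2)) inferInstance
  have hdiag : history B σ s = MeasurableSpace.comap (fun ω ↦ (ω, ω)) 𝒢 := by
    simp only [𝒢, history, MeasurableSpace.comap_iSup, MeasurableSpace.comap_comp]
    rfl
  rw [hdiag] at hA
  obtain ⟨E, hE, rfl⟩ := hA
  refine ⟨E, ?_, fun _ ↦ Iff.rfl, fun ω' hω' ↦ ?_⟩
  · refine (iSup_le fun r ↦ ?_ : 𝒢 ≤ (processSpace B).prod (processSpace σ)) E hE
    rw [← measurable_iff_comap_le]
    exact (h.measurable_decoupledLogPrice r).prodMk (h.measurable_undershoot_snd r)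
  · have hsec : MeasurableSpace.comap (fun ω ↦ (ω, ω')) 𝒢 ≤
        processPast B (undershoot σ s ω').toNNReal := by
      simp only [𝒢, MeasurableSpace.comap_iSup, MeasurableSpace.comap_comp]
      refine iSup_le fun r ↦ ?_
      rw [← measurable_iff_comap_le]
      -- At a frozen clock, `B` is read only at times H(r) ≤ H(s), and the second coordinate is
      -- constant.
      exact (measurable_processPast (Real.toNNReal_le_toNNReal (hω' r.2))).prodMk
        (measurable_const (a := undershoot σ r ω'))
    exact hsec _ ⟨E, hE, rfl⟩

theorem IsDrivingPair.ae_undershoot [IsProbabilityMeasure P] (hφ : 0 < φ 1)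
    (h : IsDrivingPair φ x v B σ P) :
    ∀ᵐ ω ∂P, (∀ t, 0 ≤ undershoot σ t ω) ∧ Monotone fun t ↦ undershoot σ t ω := by
  filter_upwards [h.subordinator.ae_unbounded hφ, h.subordinator.strictly_increasing] with ω h1 h2
  exact ⟨undershoot_nonneg h2.monotone, undershoot_mono h2.monotone h1⟩

/-- The frozen-clock mean is the same for almost every clock. Taking θ = -1/2 gives the mass of the
tilted measure, and θ = 1/2 the integrability of the price. -/
theorem IsDrivingPair.lintegral_exp_mul [IsProbabilityMeasure P] (hφ : 0 < φ 1)
    (h : IsDrivingPair φ x v B σ P) (t : ℝ≥0) (θ : ℝ) :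
    ∫⁻ ω, ENNReal.ofReal (Real.exp (θ * logPrice B σ t ω - θ ^ 2 * undershoot σ t ω / 2)) ∂P =
      ENNReal.ofReal (Real.exp (θ * x)) := by
  have hg : Measurable[(processSpace B).prod (processSpace σ)] fun p : Ω × Ω ↦ ENNReal.ofReal
      (Real.exp (θ * decoupledLogPrice B σ t p - θ ^ 2 * undershoot σ t p.2 / 2)) :=
    (Real.measurable_exp.comp (((h.measurable_decoupledLogPrice t).const_mul θ).sub
      (((h.measurable_undershoot_snd t).const_mul (θ ^ 2)).div_const 2))).ennreal_ofReal
  rw [show ∫⁻ ω, ENNReal.ofReal (Real.exp (θ * logPrice B σ t ω -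
    θ ^ 2 * undershoot σ t ω / 2)) ∂P = _ from h.lintegral_decouple hg]
  rw [lintegral_congr_ae (g := fun _ ↦ ENNReal.ofReal (Real.exp (θ * x))) ?_]
  · simp
  · filter_upwards [h.ae_undershoot hφ] with ω' hω'
    have := h.brownian.lintegral_exp_mul (undershoot σ t ω').toNNReal θ
    rwa [Real.coe_toNNReal _ (hω'.1 t)] at this

/-- This is the martingale property in disguise: the right-hand side does not depend on `t`, so `t =
s` gives the same value. -/
theorem IsDrivingPair.setLIntegral_price_mul [IsProbabilityMeasure P] (hφ : 0 < φ 1)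
    (h : IsDrivingPair φ x v B σ P) {s t T : ℝ≥0} (hst : s ≤ t) (htT : t ≤ T) {A : Set Ω}
    (hA : MeasurableSet[history B σ s] A) :
    ∫⁻ ω in A, ENNReal.ofReal (price B σ t ω) *
      ENNReal.ofReal (Real.exp (-(logPrice B σ T ω) / 2 - undershoot σ T ω / 8)) ∂P =
    ∫⁻ ω in A, ENNReal.ofReal (Real.exp (logPrice B σ s ω / 2 - undershoot σ s ω / 8)) ∂P := by
  obtain ⟨E, hE, hEA, hsec⟩ := h.exists_section hA
  have hX := h.measurable_decoupledLogPrice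
  have hH := h.measurable_undershoot_snd
  have hone : Measurable[(processSpace B).prod (processSpace σ)]
      (E.indicator fun _ ↦ (1 : ℝ≥0∞)) := measurable_const.indicator hE
  have hg₁ : Measurable[(processSpace B).prod (processSpace σ)] fun p : Ω × Ω ↦
      E.indicator (fun _ ↦ (1 : ℝ≥0∞)) p * (ENNReal.ofReal (Real.exp (decoupledLogPrice B σ t p)) *
        ENNReal.ofReal (Real.exp (-(decoupledLogPrice B σ T p) / 2 - undershoot σ T p.2 / 8))) :=
    hone.mul ((Real.measurable_exp.comp (hX t)).ennreal_ofReal.mul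
      (Real.measurable_exp.comp
        (((hX T).neg.div_const 2).sub ((hH T).div_const 8))).ennreal_ofReal)
  have hg₂ : Measurable[(processSpace B).prod (processSpace σ)] fun p : Ω × Ω ↦
      E.indicator (fun _ ↦ (1 : ℝ≥0∞)) p *
        ENNReal.ofReal (Real.exp (decoupledLogPrice B σ s p / 2 - undershoot σ s p.2 / 8)) :=
    hone.mul (Real.measurable_exp.comp
      (((hX s).div_const 2).sub ((hH s).div_const 8))).ennreal_ofReal
  have hset : ∀ g : Ω × Ω → ℝ≥0∞, ∫⁻ ω in A, g (ω, ω) ∂P =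
      ∫⁻ ω, E.indicator (fun _ ↦ (1 : ℝ≥0∞)) (ω, ω) * g (ω, ω) ∂P := by
    intro g
    rw [← lintegral_indicator (h.history_le s A hA)]
    refine lintegral_congr fun ω ↦ ?_
    by_cases hω : ω ∈ A
    · simp [hω, (hEA ω).2 hω]
    · simp [hω, mt (hEA ω).1 hω]
  have e₁ := (hset fun p ↦ ENNReal.ofReal (Real.exp (decoupledLogPrice B σ t p)) *
        ENNReal.ofReal (Real.exp (-(decoupledLogPrice B σ T p) / 2 - undershoot σ T p.2 / 8))).trans
    (h.lintegral_decouple hg₁)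
  have e₂ := (hset fun p ↦ ENNReal.ofReal (Real.exp (decoupledLogPrice B σ s p / 2 -
    undershoot σ s p.2 / 8))).trans (h.lintegral_decouple hg₂)
  refine e₁.trans (Eq.trans (lintegral_congr_ae ?_) e₂.symm)
  filter_upwards [h.ae_undershoot hφ] with ω' hω'
  have hf : Measurable[processPast B (undershoot σ s ω').toNNReal]
      fun ω ↦ E.indicator (fun _ ↦ (1 : ℝ≥0∞)) (ω, ω') :=
    measurable_const.indicator (hsec ω' hω'.2)
  have := h.brownian.lintegral_mul_exp_tilt (Real.toNNReal_le_toNNReal (hω'.2 hst))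
    (Real.toNNReal_le_toNNReal (hω'.2 htT)) hf
  rwa [Real.coe_toNNReal _ (hω'.1 s), Real.coe_toNNReal _ (hω'.1 T)] at this

end TimeChange

/-! ### From constant means to martingales under the tilted measures. -/

/-- A nonnegative adapted integrable process is a martingale as soon as its means over the events
of the past are constant in time. -/
theorem martingale_of_setLIntegral_eq {Ω ι : Type*} [Preorder ι] {mΩ : MeasurableSpace Ω}
    {ℱ : Filtration ι mΩ} {μ : Measure Ω} [IsFiniteMeasure μ] {f : ι → Ω → ℝ}
    (hadp : StronglyAdapted ℱ f) (hnonneg : ∀ i ω, 0 ≤ f i ω)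
    (hfin : ∀ i, ∫⁻ ω, ENNReal.ofReal (f i ω) ∂μ < ∞)
    (heq : ∀ i j, i ≤ j → ∀ A, MeasurableSet[ℱ i] A →
      ∫⁻ ω in A, ENNReal.ofReal (f j ω) ∂μ = ∫⁻ ω in A, ENNReal.ofReal (f i ω) ∂μ) :
    Martingale f ℱ μ := by
  have hm : ∀ i, StronglyMeasurable (f i) := fun i ↦ (hadp i).mono (ℱ.le i)
  have hint : ∀ i, Integrable (f i) μ := fun i ↦ by
    refine ⟨(hm i).aestronglyMeasurable, ?_⟩
    simpa only [HasFiniteIntegral, Real.enorm_of_nonneg (hnonneg i _)] using hfin i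
  refine ⟨hadp, fun i j hij ↦ (ae_eq_condExp_of_forall_setIntegral_eq (ℱ.le i) (hint j)
    (fun _ _ _ ↦ (hint i).integrableOn) (fun A hA _ ↦ ?_) (hadp i).aestronglyMeasurable).symm⟩
  rw [integral_eq_lintegral_of_nonneg_ae (Eventually.of_forall (hnonneg i))
      (hm i).aestronglyMeasurable, integral_eq_lintegral_of_nonneg_ae
      (Eventually.of_forall (hnonneg j)) (hm j).aestronglyMeasurable, heq i j hij A hA]

section

variable {Ω : Type*} {mΩ : MeasurableSpace Ω} {P : Measure Ω} {φ : ℝ → ℝ} {x v : ℝ}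
  {B σ : ℝ≥0 → Ω → ℝ}

theorem measurable_price_history (B σ : ℝ≥0 → Ω → ℝ) (t : ℝ≥0) :
    Measurable[history B σ t] (price B σ t) := by
  have h : Measurable[history B σ t] fun ω ↦ (logPrice B σ t ω, undershoot σ t ω) :=
    measurable_iff_comap_le.2 (le_iSup (fun s : Iic t ↦ MeasurableSpace.comap
      (fun ω ↦ (logPrice B σ (s : ℝ≥0) ω, undershoot σ (s : ℝ≥0) ω)) inferInstance)
      ⟨t, le_refl t⟩)
  exact Real.measurable_exp.comp (measurable_fst.comp h)

theorem IsDrivingPair.measurable_tilt (h : IsDrivingPair φ x v B σ P) (T : ℝ≥0) :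
    Measurable fun ω ↦
      ENNReal.ofReal (Real.exp (-(logPrice B σ T ω) / 2 - undershoot σ T ω / 8)) :=
  (Real.measurable_exp.comp (((measurable_logPrice h.brownian.measurable
    h.brownian.continuous_paths h.subordinator.measurable h.subordinator.right_continuous
    h.subordinator.left_limits T).neg.div_const 2).sub ((measurable_undershoot
    h.subordinator.measurable h.subordinator.right_continuous h.subordinator.left_limits
    T).div_const 8))).ennreal_ofReal

theorem IsDrivingPair.setLIntegral_tiltedMeasure (h : IsDrivingPair φ x v B σ P) (T : ℝ≥0)
    {g : Ω → ℝ≥0∞} (hg : Measurable[history B σ T] g) {A : Set Ω}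
    (hA : MeasurableSet[history B σ T] A) :
    ∫⁻ ω in A, g ω ∂(tiltedMeasure h T) = ∫⁻ ω in A, g ω *
      ENNReal.ofReal (Real.exp (-(logPrice B σ T ω) / 2 - undershoot σ T ω / 8)) ∂P := by
  have hle := h.history_le T
  rw [tiltedMeasure, restrict_trim hle _ hA, lintegral_trim hle hg,
    restrict_withDensity (hle A hA),
    lintegral_withDensity_eq_lintegral_mul _ (h.measurable_tilt T) (hg.mono hle le_rfl)]
  exact lintegral_congr fun ω ↦ mul_comm _ _

theorem IsDrivingPair.tiltedMeasure_univ [IsProbabilityMeasure P] (hφ : 0 < φ 1)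
    (h : IsDrivingPair φ x v B σ P) (T : ℝ≥0) :
    tiltedMeasure h T univ = ENNReal.ofReal (Real.exp (-x / 2)) := by
  have h1 := h.setLIntegral_tiltedMeasure T (g := fun _ ↦ 1) measurable_const MeasurableSet.univ
  simp only [lintegral_const, one_mul, Measure.restrict_univ] at h1
  rw [h1]
  convert h.lintegral_exp_mul hφ T (-1 / 2) using 5 <;> ring

/-- The scalar covers both measures at once: `c = exp (x / 2)` for the normalized one and `c = 1`
for the tilted one. -/
theorem IsDrivingPair.martingale_smul_tiltedMeasure [IsProbabilityMeasure P] (hφ : 0 < φ 1)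
    (h : IsDrivingPair φ x v B σ P) (T : ℝ≥0) {c : ℝ≥0∞} (hc : c ≠ ∞) :
    Martingale (fun (t : Iic T) ω ↦ price B σ (t : ℝ≥0) ω)
      (historyFiltration B σ T) (c • tiltedMeasure h T) := by
  have hfin : @IsFiniteMeasure Ω (history B σ T) (c • tiltedMeasure h T) := by
    constructor
    rw [Measure.smul_apply, h.tiltedMeasure_univ hφ, smul_eq_mul]
    exact ENNReal.mul_lt_top hc.lt_top ENNReal.ofReal_lt_top
  have key : ∀ {s t : Iic T}, s ≤ t → ∀ A, MeasurableSet[history B σ s] A →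
      ∫⁻ ω in A, ENNReal.ofReal (price B σ t ω) ∂(c • tiltedMeasure h T) =
        c * ∫⁻ ω in A, ENNReal.ofReal
          (Real.exp (logPrice B σ s ω / 2 - undershoot σ s ω / 8)) ∂P := by
    intro s t hst A hA
    rw [Measure.restrict_smul, lintegral_smul_measure, smul_eq_mul, h.setLIntegral_tiltedMeasure T
      ((measurable_price_history B σ t).mono (history_mono B σ t.2) le_rfl).ennreal_ofReal
      (history_mono B σ s.2 A hA), h.setLIntegral_price_mul hφ hst t.2 hA]
  refine martingale_of_setLIntegral_eq
    (fun t ↦ Measurable.stronglyMeasurable (measurable_price_history B σ t))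
    (fun t ω ↦ (Real.exp_pos _).le) (fun t ↦ ?_) fun s t hst A hA ↦ ?_
  · have h1 := key (le_refl t) univ MeasurableSet.univ
    simp only [Measure.restrict_univ] at h1
    rw [h1]
    refine ENNReal.mul_lt_top hc.lt_top ?_
    have h2 := h.lintegral_exp_mul hφ t (1 / 2)
    refine lt_of_eq_of_lt (Eq.trans ?_ h2) ENNReal.ofReal_lt_top
    refine lintegral_congr fun ω ↦ ?_
    congr 2
    ring
  · exact (key hst A hA).trans (key (le_refl s) A hA).symm

end

theorem proposition6 {Ω : Type*} {mΩ : MeasurableSpace Ω} (P : Measure Ω) [IsProbabilityMeasure P]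
    (φ : ℝ → ℝ) (hφ : IsBernsteinZero φ) (x v : ℝ) (B σ : ℝ≥0 → Ω → ℝ)
    (h : IsDrivingPair φ x v B σ P) (T : ℝ≥0) (hT : 0 < T) :
    IsProbabilityMeasure (pricingMeasure h T) ∧
    Martingale (fun (t : Set.Iic T) ω ↦ price B σ (t : ℝ≥0) ω)
      (historyFiltration B σ T) (pricingMeasure h T) ∧
    Martingale (fun (t : Set.Iic T) ω ↦ price B σ (t : ℝ≥0) ω)
      (historyFiltration B σ T) (tiltedMeasure h T) := by
  refine ⟨⟨?_⟩, h.martingale_smul_tiltedMeasure hφ.apply_one_pos T ENNReal.ofReal_ne_top, ?_⟩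
  · rw [pricingMeasure, Measure.smul_apply, h.tiltedMeasure_univ hφ.apply_one_pos, smul_eq_mul,
      ← ENNReal.ofReal_mul (Real.exp_pos _).le, ← Real.exp_add]
    simp [neg_div]
  · simpa only [one_smul] using
      h.martingale_smul_tiltedMeasure hφ.apply_one_pos T ENNReal.one_ne_top
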